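/- Let $X=\{u(1+i)+v(1-i) : u,v\in\mathbb{R},\ -\tfrac12\le u,v<\tfrac12\}\subset\mathbb{C}$. For $z=u(1+i)+v(1-i)$ with $u,v\in\mathbb{R}$ put $$\lfloor z\rfloor_T=\lfloor u+\tfrac12\rfloor(1+i)+\lfloor v+\tfrac12\rfloor(1-i),$$ and let $T_T\colon X\to X$ be Tanaka's map, $T_T(z)=\frac1z-\lfloor \frac1z\rfloor_T$ for $z\neq 0$ and $T_T(0)=0$. For $\alpha\in X$, the Tanaka orbit $(\alpha_{(n)}^T)_{n\ge 1}$ is defined by $\alpha_{(1)}^T=\alpha$ and $\alpha_{(n+1)}^T=T_T(\alpha_{(n)}^T)$, where the sequence terminates at the first $n$ with $\alpha_{(n)}^T=0$. If $\alpha\in X\setminus\mathbb{Q}(i)$ is quadratic over $\mathbb{Q}(i)$, then its Tanaka orbit does not terminate and is eventually periodic: $\alpha_{(n)}^T\neq 0$ for all $n\ge 1$, and there are integers $N\ge 1$ and $p\ge 1$ such that $\alpha_{(n+p)}^T=\alpha_{(n)}^T$ for all $n\ge N$. -/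

import Mathlib

open Complex

noncomputable section

/-- The field `ℚ(i)`, as a subfield of `ℂ`. -/
abbrev GaussianRationals : IntermediateField ℚ ℂ :=
  IntermediateField.adjoin ℚ {Complex.I}

/-- The half-open square `X = {u(1+i) + v(1-i) : -1/2 ≤ u, v < 1/2}`. -/
def tanakaDomain : Set ℂ :=
  {z | ∃ u v : ℝ, (-(1 / 2) ≤ u ∧ u < 1 / 2) ∧ (-(1 / 2) ≤ v ∧ v < 1 / 2) ∧
    z = (u : ℂ) * (1 + I) + (v : ℂ) * (1 - I)}

/-- The coordinate `u` of `z = u(1+i) + v(1-i)`. -/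
def coordU (z : ℂ) : ℝ := (z.re + z.im) / 2

/-- The coordinate `v` of `z = u(1+i) + v(1-i)`. -/
def coordV (z : ℂ) : ℝ := (z.re - z.im) / 2

/-- `coordU z` and `coordV z` are the unique real coordinates of `z` in the basis
`1 + i`, `1 - i`. -/
theorem eq_coord_iff (z : ℂ) (u v : ℝ) :
    z = (u : ℂ) * (1 + I) + (v : ℂ) * (1 - I) ↔ u = coordU z ∧ v = coordV z := by
  simp only [Complex.ext_iff, coordU, coordV]
  simp
  constructor
  · rintro ⟨h1, h2⟩
    constructor <;> linarith
  · rintro ⟨h1, h2⟩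
    constructor <;> linarith

/-- `⌊z⌋_T = ⌊u + 1/2⌋(1+i) + ⌊v + 1/2⌋(1-i)` for `z = u(1+i) + v(1-i)` with `u, v` real. -/
def tanakaFloor (z : ℂ) : ℂ :=
  (⌊coordU z + 1 / 2⌋ : ℂ) * (1 + I) + (⌊coordV z + 1 / 2⌋ : ℂ) * (1 - I)

open Classical in
/-- Tanaka's map `T_T`: `T_T(z) = 1/z - ⌊1/z⌋_T` for `z ≠ 0`, and `T_T(0) = 0`. -/
def tanakaMap (z : ℂ) : ℂ :=
  if z = 0 then 0 else 1 / z - tanakaFloor (1 / z)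

/-- Every value of Tanaka's map lies in the square `X`, so that it is a self-map of `X`. -/
theorem tanakaMap_mem (z : ℂ) : tanakaMap z ∈ tanakaDomain := by
  unfold tanakaMap
  split_ifs with h
  · exact ⟨0, 0, by norm_num, by norm_num, by simp⟩
  · have hz := (eq_coord_iff (1 / z) _ _).2 ⟨rfl, rfl⟩
    have h1 := Int.floor_le (coordU (1 / z) + 1 / 2)
    have h2 := Int.lt_floor_add_one (coordU (1 / z) + 1 / 2)
    have h3 := Int.floor_le (coordV (1 / z) + 1 / 2)
    have h4 := Int.lt_floor_add_one (coordV (1 / z) + 1 / 2)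
    refine ⟨coordU (1 / z) - ⌊coordU (1 / z) + 1 / 2⌋,
      coordV (1 / z) - ⌊coordV (1 / z) + 1 / 2⌋,
      ⟨by linarith, by linarith⟩, ⟨by linarith, by linarith⟩, ?_⟩
    conv_lhs => lhs; rw [hz]
    rw [tanakaFloor]
    push_cast
    ring

/-- The Tanaka orbit of `α`, indexed from `0`: `tanakaOrbit α n` is `α_(n+1)`, so that
`tanakaOrbit α 0 = α` and `tanakaOrbit α (n + 1) = tanakaMap (tanakaOrbit α n)`.
The algorithm terminates at the first term equal to `0`; the terms after such a term are
again `0` here, so that an orbit is infinite exactly when none of its terms is `0`. -/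
def tanakaOrbit (α : ℂ) (n : ℕ) : ℂ := tanakaMap^[n] α

/-- A sequence is eventually periodic if from some index on it has a positive period. -/
def IsEventuallyPeriodic (s : ℕ → ℂ) : Prop :=
  ∃ N p : ℕ, 0 < p ∧ ∀ n, N ≤ n → s (n + p) = s n

/-- `α` is quadratic over `ℚ(i)`: it is algebraic of degree two over that field. -/
def IsQuadraticOverGaussianRationals (α : ℂ) : Prop :=
  IsIntegral GaussianRationals α ∧ (minpoly GaussianRationals α).natDegree = 2

end

/-! Apply the digits of the orbit z_n of α also to its conjugate, giving z'_n. Both are roots of a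
quadratic over the Gaussian integers whose leading coefficient E_n keeps |E_n||z_n - z'_n| constant
(`exists_form`). Where |z_n - z'_n| ≥ 1/100 the coefficients are bounded, so z_n lies in a finite
set. If this happens infinitely often, a value repeats and the orbit is periodic from there on.
Non-termination holds because the orbit never enters ℚ(i).

The work is `exists_norm_sub_ge`: the gap cannot stay below 1/100. A step divides it by |z||z'|,
which expands except near the corners ±1, ±i. Digits are even, so a corner u goes to an odd Gaussian
integer v, and |z - z'|/(|z - u||z' - u|) keeps its value with v for u. A whole excursion near
corners thus costs at most a factor 9/10, while a step from a far point gains 1/(0.9 · 0.91). The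
net factor exceeds 21/20, so a gap that stayed small would grow without bound. -/

open Polynomial

/-! ### Parity of Gaussian integers -/

/-- The Gaussian integers `x + y i` with `x + y` odd. -/
def oddGaussian : Set ℂ := {z | ∃ x y : ℤ, z = (x : ℂ) + (y : ℂ) * I ∧ Odd (x + y)}

/-- The Gaussian integers `x + y i` with `x + y` even. -/
def evenGaussian : Set ℂ := {z | ∃ x y : ℤ, z = (x : ℂ) + (y : ℂ) * I ∧ Even (x + y)}

/-- The Gaussian integers, as a subring of `ℂ`. -/
def gaussianSubring : Subring ℂ := GaussianInt.toComplex.range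

theorem mem_gaussianSubring_iff (z : ℂ) :
    z ∈ gaussianSubring ↔ ∃ x y : ℤ, z = (x : ℂ) + (y : ℂ) * I := by
  constructor
  · rintro ⟨w, rfl⟩
    exact ⟨w.re, w.im, GaussianInt.toComplex_def w⟩
  · rintro ⟨x, y, rfl⟩
    exact ⟨⟨x, y⟩, GaussianInt.toComplex_def' x y⟩

theorem evenGaussian_subset {z : ℂ} (h : z ∈ evenGaussian) : z ∈ gaussianSubring := by
  obtain ⟨x, y, h, -⟩ := h
  exact (mem_gaussianSubring_iff z).2 ⟨x, y, h⟩

theorem oddGaussian_subset {z : ℂ} (h : z ∈ oddGaussian) : z ∈ gaussianSubring := by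
  obtain ⟨x, y, h, -⟩ := h
  exact (mem_gaussianSubring_iff z).2 ⟨x, y, h⟩

theorem sub_mem_oddGaussian {u a : ℂ} (hu : u ∈ oddGaussian) (ha : a ∈ evenGaussian) :
    u - a ∈ oddGaussian := by
  obtain ⟨x, y, rfl, h⟩ := hu
  obtain ⟨s, t, rfl, h'⟩ := ha
  refine ⟨x - s, y - t, by push_cast; ring, ?_⟩
  have := h.sub_even h'
  rwa [show x - s + (y - t) = x + y - (s + t) by ring]

theorem tanakaFloor_mem (z : ℂ) : tanakaFloor z ∈ evenGaussian := by
  refine ⟨⌊coordU z + 1 / 2⌋ + ⌊coordV z + 1 / 2⌋, ⌊coordU z + 1 / 2⌋ - ⌊coordV z + 1 / 2⌋, ?_, ?_⟩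
  · rw [tanakaFloor]; push_cast; ring
  · exact ⟨⌊coordU z + 1 / 2⌋, by ring⟩

theorem abs_re_add_abs_im_le {z : ℂ} (h : z ∈ tanakaDomain) : |z.re| + |z.im| ≤ 1 := by
  obtain ⟨u, v, ⟨h1, h2⟩, ⟨h3, h4⟩, rfl⟩ := h
  simp
  rcases abs_cases (u + v) with h | h <;> rcases abs_cases (u + -v) with h' | h' <;> linarith

theorem norm_le_one_of_abs {z : ℂ} (h : |z.re| + |z.im| ≤ 1) : ‖z‖ ≤ 1 :=
  (Complex.norm_le_abs_re_add_abs_im z).trans h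

theorem unit_of_norm_lt {u : ℂ} (hu : u ∈ oddGaussian) (h : ‖u‖ < 4 / 3) :
    u = 1 ∨ u = -1 ∨ u = I ∨ u = -I := by
  obtain ⟨x, y, rfl, hodd⟩ := hu
  have h2 : ‖(x : ℂ) + (y : ℂ) * I‖ ^ 2 < (4 / 3) ^ 2 := by gcongr
  rw [Complex.sq_norm, Complex.normSq_apply] at h2
  simp at h2
  have h3 : x ^ 2 + y ^ 2 < 2 := by
    have : ((x ^ 2 + y ^ 2 : ℤ) : ℝ) < (2 : ℤ) := by
      push_cast; linarith
    exact_mod_cast this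
  have hx : -1 ≤ x ∧ x ≤ 1 := ⟨by nlinarith [sq_nonneg y], by nlinarith [sq_nonneg y]⟩
  have hy : -1 ≤ y ∧ y ≤ 1 := ⟨by nlinarith [sq_nonneg x], by nlinarith [sq_nonneg x]⟩
  obtain ⟨hx1, hx2⟩ := hx
  obtain ⟨hy1, hy2⟩ := hy
  interval_cases x <;> interval_cases y <;> first | (simp; done) | (exfalso; revert hodd; decide)

theorem one_mem_oddGaussian : (1 : ℂ) ∈ oddGaussian := ⟨1, 0, by simp, by decide⟩
theorem neg_one_mem_oddGaussian : (-1 : ℂ) ∈ oddGaussian := ⟨-1, 0, by simp, by decide⟩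
theorem I_mem_oddGaussian : I ∈ oddGaussian := ⟨0, 1, by simp, by decide⟩
theorem neg_I_mem_oddGaussian : -I ∈ oddGaussian := ⟨0, -1, by simp, by decide⟩

/-! ### Norm estimates on the square, near and far from its corners -/

theorem sq_add_sq_le_one_sub {x y e : ℝ} (h : |x| + |y| ≤ 1) (he : 0 ≤ e) (he' : e < 1 / 3)
    (hxy : e ^ 2 = (x - 1) ^ 2 + y ^ 2) : x ^ 2 + y ^ 2 ≤ 1 - e := by
  have hx : |y| ≤ 1 - x := by linarith [le_abs_self x]
  have hy0 := abs_nonneg y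
  have hy : y ^ 2 ≤ (1 - x) ^ 2 := by
    rw [← sq_abs y]; gcongr
  -- Since |y| ≤ 1 - x, e ≤ √2 (1 - x); then x² + y² = 1 - 2(1 - x) + e² ≤ 1 - 4e/3 + e/3.
  have h3 : e ≤ 3 / 2 * (1 - x) := by
    refine (abs_le_of_sq_le_sq' ?_ (by linarith)).2
    nlinarith
  nlinarith

theorem norm_sq_le_one_sub {z u : ℂ} (hz : |z.re| + |z.im| ≤ 1)
    (hu : u = 1 ∨ u = -1 ∨ u = I ∨ u = -I) (h : ‖z - u‖ < 1 / 3) :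
    ‖z‖ ^ 2 ≤ 1 - ‖z - u‖ := by
  have hs : ‖z - u‖ ^ 2 = (z.re - u.re) ^ 2 + (z.im - u.im) ^ 2 := by
    rw [Complex.sq_norm, Complex.normSq_apply]; simp; ring
  have hz2 : ‖z‖ ^ 2 = z.re ^ 2 + z.im ^ 2 := by
    rw [Complex.sq_norm, Complex.normSq_apply]; ring
  have h0 := norm_nonneg (z - u)
  generalize ‖z - u‖ = e at *
  rw [hz2]
  rcases hu with rfl | rfl | rfl | rfl <;> simp at hs
  · exact sq_add_sq_le_one_sub hz h0 h (by rw [hs])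
  · have := sq_add_sq_le_one_sub (x := -z.re) (y := z.im) (by rwa [abs_neg]) h0 h (by rw [hs]; ring)
    linarith
  · have := sq_add_sq_le_one_sub (x := z.im) (y := z.re) (by linarith) h0 h (by rw [hs]; ring)
    linarith
  · have := sq_add_sq_le_one_sub (x := -z.im) (y := z.re) (by rw [abs_neg]; linarith) h0 h
      (by rw [hs]; ring)
    linarith

theorem sq_add_sq_le_of_far {x y : ℝ} (h : x + |y| ≤ 1) (hyx : |y| ≤ x)
    (h1 : 1 / 9 ≤ (x - 1) ^ 2 + y ^ 2) : x ^ 2 + y ^ 2 ≤ 81 / 100 := by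
  rw [← sq_abs y] at *
  have hy0 := abs_nonneg y
  generalize |y| = t at *
  -- Otherwise (x - 1)² + y² ≤ 2 · 0.19² < 1/9. Afterwards y² ≤ x(1 - x) gives x² + y² ≤ x.
  have : x ≤ 81 / 100 := by
    by_contra hx
    push Not at hx
    nlinarith
  nlinarith

theorem norm_le_of_far {z : ℂ} (hz : |z.re| + |z.im| ≤ 1)
    (h : ∀ u ∈ oddGaussian, 1 / 3 ≤ ‖z - u‖) : ‖z‖ ≤ 9 / 10 := by
  have key : ∀ u ∈ oddGaussian, 1 / 9 ≤ (z.re - u.re) ^ 2 + (z.im - u.im) ^ 2 := by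
    intro u hu
    have h2 : (1 / 3 : ℝ) ^ 2 ≤ ‖z - u‖ ^ 2 := by gcongr; exact h u hu
    rw [Complex.sq_norm, Complex.normSq_apply] at h2
    simp at h2
    linarith
  have h1 := key _ one_mem_oddGaussian
  have h2 := key _ neg_one_mem_oddGaussian
  have h3 := key _ I_mem_oddGaussian
  have h4 := key _ neg_I_mem_oddGaussian
  simp at h1 h2 h3 h4
  refine (abs_le_of_sq_le_sq' ?_ (by norm_num)).2
  rw [Complex.sq_norm, Complex.normSq_apply]
  rcases le_total |z.im| |z.re| with hle | hle
  · rcases abs_cases z.re with ⟨ha, -⟩ | ⟨ha, -⟩ <;> rw [ha] at hz hle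
    · linarith [sq_add_sq_le_of_far hz hle (by linarith)]
    · linarith [sq_add_sq_le_of_far hz hle (by linarith)]
  · rw [add_comm] at hz
    rcases abs_cases z.im with ⟨ha, -⟩ | ⟨ha, -⟩ <;> rw [ha] at hz hle
    · linarith [sq_add_sq_le_of_far hz hle (by linarith)]
    · linarith [sq_add_sq_le_of_far hz hle (by linarith)]

theorem one_le_norm_sub_of_ne {u v : ℂ} (hu : u ∈ oddGaussian) (hv : v ∈ oddGaussian)
    (h : u ≠ v) : 1 ≤ ‖u - v‖ := by
  obtain ⟨w, hw⟩ := gaussianSubring.sub_mem (oddGaussian_subset hu) (oddGaussian_subset hv)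
  have hw0 : w ≠ 0 := by
    rintro rfl
    simp at hw
    exact h (sub_eq_zero.1 hw.symm)
  have h1 : (1 : ℤ) ≤ w.norm := by
    have := GaussianInt.norm_pos.2 hw0
    omega
  have h2 : (1 : ℝ) ≤ ‖u - v‖ ^ 2 := by
    rw [Complex.sq_norm, ← hw]
    have := GaussianInt.intCast_real_norm w
    rw [← this]
    exact_mod_cast h1
  exact (one_le_sq_iff₀ (norm_nonneg _)).1 h2

/-! ### Expansion of the gap between two sequences with common digits -/

/-- Two sequences of nonzero complex numbers produced by inversions and subtractions of the same
even Gaussian integers, the first staying in the closed square with vertices `±1, ±i`. -/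
structure DigitPair (z z' a : ℕ → ℂ) : Prop where
  abs_le : ∀ n, |(z n).re| + |(z n).im| ≤ 1
  ne_zero : ∀ n, z n ≠ 0
  ne_zero' : ∀ n, z' n ≠ 0
  not_mem : ∀ n, z n ∉ oddGaussian
  not_mem' : ∀ n, z' n ∉ oddGaussian
  ne : ∀ n, z n ≠ z' n
  digit : ∀ n, a n ∈ evenGaussian
  succ : ∀ n, z (n + 1) = 1 / z n - a n
  succ' : ∀ n, z' (n + 1) = 1 / z' n - a n

namespace DigitPair

variable {z z' a : ℕ → ℂ}

theorem shift (h : DigitPair z z' a) (N : ℕ) :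
    DigitPair (fun n => z (n + N)) (fun n => z' (n + N)) (fun n => a (n + N)) where
  abs_le n := h.abs_le _
  ne_zero n := h.ne_zero _
  ne_zero' n := h.ne_zero' _
  not_mem n := h.not_mem _
  not_mem' n := h.not_mem' _
  ne n := h.ne _
  digit n := h.digit _
  succ n := by rw [show n + 1 + N = n + N + 1 by ring]; exact h.succ _
  succ' n := by rw [show n + 1 + N = n + N + 1 by ring]; exact h.succ' _

theorem norm_sub_succ (h : DigitPair z z' a) (n : ℕ) :
    ‖z (n + 1) - z' (n + 1)‖ = ‖z n - z' n‖ / (‖z n‖ * ‖z' n‖) := by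
  have h1 := h.ne_zero n
  have h2 := h.ne_zero' n
  rw [h.succ, h.succ', ← norm_mul, ← norm_div, ← norm_neg]
  congr 1
  field_simp
  ring

theorem norm_pos (h : DigitPair z z' a) (n : ℕ) : 0 < ‖z n‖ := norm_pos_iff.2 (h.ne_zero n)

theorem norm_pos' (h : DigitPair z z' a) (n : ℕ) : 0 < ‖z' n‖ := norm_pos_iff.2 (h.ne_zero' n)

theorem norm_sub_pos (h : DigitPair z z' a) (n : ℕ) {u : ℂ} (hu : u ∈ oddGaussian) :
    0 < ‖z n - u‖ :=
  norm_pos_iff.2 (sub_ne_zero.2 fun e => h.not_mem n (e ▸ hu))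

theorem norm_sub_pos' (h : DigitPair z z' a) (n : ℕ) {u : ℂ} (hu : u ∈ oddGaussian) :
    0 < ‖z' n - u‖ :=
  norm_pos_iff.2 (sub_ne_zero.2 fun e => h.not_mem' n (e ▸ hu))

theorem unit_of_near (h : DigitPair z z' a) {n : ℕ} {u : ℂ} (hu : u ∈ oddGaussian)
    (hn : ‖z n - u‖ < 1 / 3) : u = 1 ∨ u = -1 ∨ u = I ∨ u = -I := by
  apply unit_of_norm_lt hu
  have h1 := norm_le_one_of_abs (h.abs_le n)
  have h2 : ‖u‖ ≤ ‖z n‖ + ‖z n - u‖ := by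
    have := norm_sub_le (z n) (z n - u)
    simpa using this
  linarith

theorem near_step (h : DigitPair z z' a) {n : ℕ} {u : ℂ} (hu : u ∈ oddGaussian)
    (hn : ‖z n - u‖ < 1 / 3) :
    ∃ v ∈ oddGaussian, ‖z (n + 1) - v‖ = ‖z n - u‖ / ‖z n‖ ∧
      ‖z' (n + 1) - v‖ = ‖z' n - u‖ / ‖z' n‖ ∧
      (‖z (n + 1) - v‖ < 1 / 3 ∨ ∀ w ∈ oddGaussian, 1 / 3 ≤ ‖z (n + 1) - w‖) := by
  have hunit := h.unit_of_near hu hn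
  have h0 : u ≠ 0 ∧ ‖u‖ = 1 ∧ 1 / u ∈ oddGaussian := by
    rcases hunit with rfl | rfl | rfl | rfl
    · simp [one_mem_oddGaussian]
    · simp [neg_one_mem_oddGaussian]
    · simp [neg_I_mem_oddGaussian]
    · simp [I_mem_oddGaussian]
  obtain ⟨hu0, hu1, hu2⟩ := h0
  have e : ∀ w : ℂ, w ≠ 0 → ‖1 / w - a n - (1 / u - a n)‖ = ‖w - u‖ / ‖w‖ := by
    intro w hw
    have : 1 / w - a n - (1 / u - a n) = -((w - u) / (w * u)) := by
      field_simp
      ring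
    rw [this, norm_neg, norm_div, norm_mul, hu1, mul_one]
  have e1 : ‖z (n + 1) - (1 / u - a n)‖ = ‖z n - u‖ / ‖z n‖ := by
    rw [h.succ]; exact e _ (h.ne_zero n)
  have hv := sub_mem_oddGaussian hu2 (h.digit n)
  refine ⟨1 / u - a n, hv, e1, by rw [h.succ']; exact e _ (h.ne_zero' n), ?_⟩
  -- The new distance to v is below 1/2, so a second odd point within 1/3 would be closer than 1 to
  -- v.
  by_contra hcon
  push Not at hcon
  obtain ⟨hc1, w, hw, hc2⟩ := hcon
  have hne : w ≠ 1 / u - a n := by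
    rintro rfl
    linarith
  have h1 := one_le_norm_sub_of_ne hw hv hne
  have h2 : ‖w - (1 / u - a n)‖ ≤ ‖z (n + 1) - w‖ + ‖z (n + 1) - (1 / u - a n)‖ := by
    rw [norm_sub_rev (z (n + 1)) w]
    have := norm_add_le (w - z (n + 1)) (z (n + 1) - (1 / u - a n))
    simpa using this
  have h3 : 2 / 3 < ‖z n‖ := by
    have := norm_sub_norm_le u (z n)
    rw [norm_sub_rev] at this
    linarith
  have h4 : ‖z n - u‖ / ‖z n‖ < 1 / 2 := by
    rw [div_lt_iff₀ (by linarith)]; linarith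
  linarith

/-- Each near step divides both the gap and the product of distances to the odd point by ‖z‖‖z'‖, so
their ratio is conserved. The squared distance of z gains a factor at least 1 + ‖z n - u‖ because
‖z‖² ≤ 1 - ‖z n - u‖; this forces escape. -/
theorem near_run (h : DigitPair z z' a) {n : ℕ} {u : ℂ} (hu : u ∈ oddGaussian)
    (hn : ‖z n - u‖ < 1 / 3) (k : ℕ) :
    (∃ m ≥ n, (∀ w ∈ oddGaussian, 1 / 3 ≤ ‖z m - w‖) ∧ ∃ v ∈ oddGaussian,
      ‖z m - z' m‖ * (‖z n - u‖ * ‖z' n - u‖) = ‖z n - z' n‖ * (‖z m - v‖ * ‖z' m - v‖)) ∨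
    ∃ v ∈ oddGaussian, ‖z (n + k) - v‖ < 1 / 3 ∧
      ‖z n - u‖ ^ 2 * (1 + ‖z n - u‖) ^ k ≤ ‖z (n + k) - v‖ ^ 2 ∧
      ‖z (n + k) - z' (n + k)‖ * (‖z n - u‖ * ‖z' n - u‖) =
        ‖z n - z' n‖ * (‖z (n + k) - v‖ * ‖z' (n + k) - v‖) := by
  induction k with
  | zero => exact Or.inr ⟨u, hu, hn, by simp, rfl⟩
  | succ k ih =>
    rcases ih with ih | ⟨v, hv, h1, h2, h3⟩
    · exact Or.inl ih
    obtain ⟨w, hw, e1, e2, hor⟩ := h.near_step hv h1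
    have hz := h.norm_pos (n + k)
    have hz' := h.norm_pos' (n + k)
    have hF : ‖z (n + k + 1) - z' (n + k + 1)‖ * (‖z n - u‖ * ‖z' n - u‖) =
        ‖z n - z' n‖ * (‖z (n + k + 1) - w‖ * ‖z' (n + k + 1) - w‖) := by
      rw [e1, e2, h.norm_sub_succ, div_mul_eq_mul_div, h3]
      field_simp
    rcases hor with hor | hor
    · refine Or.inr ⟨w, hw, hor, ?_, hF⟩
      have he := h.norm_sub_pos n hu
      have hmono : ‖z n - u‖ ≤ ‖z (n + k) - v‖ := by
        have : ‖z n - u‖ ^ 2 ≤ ‖z (n + k) - v‖ ^ 2 :=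
          (le_mul_of_one_le_right (by positivity) (one_le_pow₀ (by linarith))).trans h2
        exact (abs_le_of_sq_le_sq' this (norm_nonneg _)).2
      have hsq := norm_sq_le_one_sub (h.abs_le (n + k)) (h.unit_of_near hv h1) h1
      change _ ≤ ‖z (n + k + 1) - w‖ ^ 2
      rw [e1, div_pow, le_div_iff₀ (by positivity), pow_succ]
      have h5 : (1 + ‖z n - u‖) * ‖z (n + k)‖ ^ 2 ≤ 1 := by
        have : (1 + ‖z n - u‖) * ‖z (n + k)‖ ^ 2 ≤ (1 + ‖z n - u‖) * (1 - ‖z n - u‖) := by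
          gcongr; linarith
        nlinarith
      calc ‖z n - u‖ ^ 2 * ((1 + ‖z n - u‖) ^ k * (1 + ‖z n - u‖)) * ‖z (n + k)‖ ^ 2
          = ‖z n - u‖ ^ 2 * (1 + ‖z n - u‖) ^ k * ((1 + ‖z n - u‖) * ‖z (n + k)‖ ^ 2) := by ring
        _ ≤ ‖z n - u‖ ^ 2 * (1 + ‖z n - u‖) ^ k * 1 := by gcongr
        _ ≤ _ := by rw [mul_one]; exact h2
    · exact Or.inl ⟨n + k + 1, by omega, hor, w, hw, hF⟩

theorem exists_far_of_near (h : DigitPair z z' a) {n : ℕ} {u : ℂ} (hu : u ∈ oddGaussian)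
    (hn : ‖z n - u‖ < 1 / 3) :
    ∃ m ≥ n, (∀ w ∈ oddGaussian, 1 / 3 ≤ ‖z m - w‖) ∧ ∃ v ∈ oddGaussian,
      ‖z m - z' m‖ * (‖z n - u‖ * ‖z' n - u‖) =
        ‖z n - z' n‖ * (‖z m - v‖ * ‖z' m - v‖) := by
  have he := h.norm_sub_pos n hu
  obtain ⟨k, hk⟩ := pow_unbounded_of_one_lt (1 / ‖z n - u‖ ^ 2)
    (show 1 < 1 + ‖z n - u‖ by linarith)
  rcases h.near_run hu hn k with hm | ⟨v, -, h1, h2, -⟩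
  · exact hm
  · exfalso
    rw [div_lt_iff₀ (by positivity)] at hk
    nlinarith [norm_nonneg (z (n + k) - v)]

theorem exists_far_ge (h : DigitPair z z' a) (hc : ∀ n, ‖z n - z' n‖ < 1 / 100) (n : ℕ) :
    ∃ m ≥ n, (∀ w ∈ oddGaussian, 1 / 3 ≤ ‖z m - w‖) ∧
      9 / 10 * ‖z n - z' n‖ ≤ ‖z m - z' m‖ := by
  by_cases hfar : ∀ w ∈ oddGaussian, 1 / 3 ≤ ‖z n - w‖
  · exact ⟨n, le_rfl, hfar, by linarith [norm_nonneg (z n - z' n)]⟩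
  push Not at hfar
  obtain ⟨u, hu, hn⟩ := hfar
  obtain ⟨m, hm, hfar, v, hv, hF⟩ := h.exists_far_of_near hu hn
  refine ⟨m, hm, hfar, ?_⟩
  have h1 := h.norm_sub_pos n hu
  have h2 := h.norm_sub_pos' n hu
  have h3 := hfar v hv
  have h4 : ‖z' n - u‖ ≤ 1 / 3 + 1 / 100 := by
    have := norm_sub_le (z n - u) (z n - z' n)
    rw [show z n - u - (z n - z' n) = z' n - u by ring] at this
    linarith [hc n]
  have h5 : 1 / 3 - 1 / 100 ≤ ‖z' m - v‖ := by
    have := norm_add_le (z m - z' m) (z' m - v)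
    rw [sub_add_sub_cancel] at this
    linarith [hc m]
  have h6 : ‖z n - u‖ * ‖z' n - u‖ ≤ 1 / 3 * (1 / 3 + 1 / 100) := by gcongr
  have h7 : 1 / 3 * (1 / 3 - 1 / 100) ≤ ‖z m - v‖ * ‖z' m - v‖ := by gcongr
  have h8 : ‖z n - z' n‖ * (1 / 3 * (1 / 3 - 1 / 100)) ≤
      ‖z m - z' m‖ * (1 / 3 * (1 / 3 + 1 / 100)) := by
    calc _ ≤ ‖z n - z' n‖ * (‖z m - v‖ * ‖z' m - v‖) := by gcongr
      _ = ‖z m - z' m‖ * (‖z n - u‖ * ‖z' n - u‖) := hF.symm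
      _ ≤ _ := by gcongr
  -- (1/3 - 1/100)/(1/3 + 1/100) > 9/10.
  linarith [norm_nonneg (z n - z' n)]

theorem exists_far_growth (h : DigitPair z z' a) (hc : ∀ n, ‖z n - z' n‖ < 1 / 100) (k : ℕ) :
    ∃ m, (∀ w ∈ oddGaussian, 1 / 3 ≤ ‖z m - w‖) ∧
      (9 / 10 * ‖z 0 - z' 0‖) * (21 / 20) ^ k ≤ ‖z m - z' m‖ := by
  induction k with
  | zero =>
    obtain ⟨m, -, h1, h2⟩ := h.exists_far_ge hc 0
    exact ⟨m, h1, by simpa using h2⟩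
  | succ k ih =>
    obtain ⟨n, h1, h2⟩ := ih
    -- Starting at n + 1 takes the expanding step from the far point n before any new excursion.
    obtain ⟨m, -, h3, h4⟩ := h.exists_far_ge hc (n + 1)
    refine ⟨m, h3, le_trans ?_ h4⟩
    have h5 := norm_le_of_far (h.abs_le n) h1
    have h6 : ‖z' n‖ ≤ 91 / 100 := by
      have := norm_sub_le (z n) (z n - z' n)
      rw [sub_sub_cancel] at this
      linarith [hc n]
    have hz := h.norm_pos n
    have hz' := h.norm_pos' n
    have h7 : ‖z n‖ * ‖z' n‖ ≤ 9 / 10 * (91 / 100) := by gcongr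
    have h8 : ‖z n - z' n‖ / (9 / 10 * (91 / 100)) ≤ ‖z (n + 1) - z' (n + 1)‖ := by
      rw [h.norm_sub_succ]
      gcongr
    rw [div_le_iff₀ (by norm_num)] at h8
    rw [pow_succ, ← mul_assoc]
    generalize 9 / 10 * ‖z 0 - z' 0‖ * (21 / 20) ^ k = t at h2 ⊢
    linarith [norm_nonneg (z n - z' n)]

theorem exists_norm_sub_ge (h : DigitPair z z' a) (N : ℕ) :
    ∃ n ≥ N, 1 / 100 ≤ ‖z n - z' n‖ := by
  by_contra! hcon
  have hs := h.shift N
  have hc : ∀ n, ‖z (n + N) - z' (n + N)‖ < 1 / 100 := fun n => hcon _ (by omega)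
  have h0 : 0 < ‖z (0 + N) - z' (0 + N)‖ := norm_pos_iff.2 (sub_ne_zero.2 (h.ne _))
  obtain ⟨k, hk⟩ := pow_unbounded_of_one_lt (1 / (9 / 10 * ‖z (0 + N) - z' (0 + N)‖))
    (show (1 : ℝ) < 21 / 20 by norm_num)
  obtain ⟨m, -, hm⟩ := hs.exists_far_growth hc k
  rw [div_lt_iff₀ (by positivity)] at hk
  have := hc m
  linarith

/-- The conjugate points are the roots of integral quadratic forms of constant discriminant. -/
theorem exists_form (h : DigitPair z z' a) {A : ℂ} (hA : A ∈ gaussianSubring) (hA0 : A ≠ 0)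
    (hB : A * (z 0 + z' 0) ∈ gaussianSubring) (hC : A * (z 0 * z' 0) ∈ gaussianSubring) (n : ℕ) :
    ∃ E ∈ gaussianSubring, E ≠ 0 ∧ E * (z n + z' n) ∈ gaussianSubring ∧
      E * (z n * z' n) ∈ gaussianSubring ∧
      ‖E‖ * ‖z n - z' n‖ = ‖A‖ * ‖z 0 - z' 0‖ := by
  induction n with
  | zero => exact ⟨A, hA, hA0, hB, hC, rfl⟩
  | succ n ih =>
    obtain ⟨E, hE, hE0, h1, h2, h3⟩ := ih
    have hz := h.ne_zero n
    have hz' := h.ne_zero' n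
    have ha := evenGaussian_subset (h.digit n)
    -- Inversion reverses the coefficients of the form, so the constant term becomes the leading
    -- one.
    refine ⟨E * (z n * z' n), h2, by simp [*], ?_, ?_, ?_⟩
    · have : E * (z n * z' n) * (z (n + 1) + z' (n + 1)) =
          E * (z n + z' n) - (E * (z n * z' n)) * a n - (E * (z n * z' n)) * a n := by
        rw [h.succ, h.succ']
        field_simp
        ring
      rw [this]
      exact sub_mem (sub_mem h1 (mul_mem h2 ha)) (mul_mem h2 ha)
    · have : E * (z n * z' n) * (z (n + 1) * z' (n + 1)) =
          E - (E * (z n + z' n)) * a n + (E * (z n * z' n)) * a n * a n := by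
        rw [h.succ, h.succ']
        field_simp
        ring
      rw [this]
      exact add_mem (sub_mem hE (mul_mem h1 ha)) (mul_mem (mul_mem h2 ha) ha)
    · have := h.norm_pos n
      have := h.norm_pos' n
      rw [h.norm_sub_succ, norm_mul, norm_mul, ← h3]
      field_simp

end DigitPair

/-! ### Finiteness and repetition -/

theorem finite_gaussian_norm_le (M : ℝ) : {z : ℂ | z ∈ gaussianSubring ∧ ‖z‖ ≤ M}.Finite := by
  apply ((Set.finite_Icc (-⌈M⌉) ⌈M⌉).prod (Set.finite_Icc (-⌈M⌉) ⌈M⌉)).image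
    (fun p : ℤ × ℤ => (p.1 : ℂ) + (p.2 : ℂ) * I) |>.subset
  rintro z ⟨hz, hM⟩
  obtain ⟨x, y, rfl⟩ := (mem_gaussianSubring_iff z).1 hz
  have h1 := (Complex.abs_re_le_norm _).trans hM
  have h2 := (Complex.abs_im_le_norm _).trans hM
  simp at h1 h2
  have aux : ∀ t : ℤ, |(t : ℝ)| ≤ M → t ∈ Set.Icc (-⌈M⌉) ⌈M⌉ := by
    intro t ht
    have : |(t : ℝ)| ≤ (⌈M⌉ : ℝ) := ht.trans (Int.le_ceil M)
    have : |t| ≤ ⌈M⌉ := by exact_mod_cast this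
    exact abs_le.1 this
  exact ⟨(x, y), ⟨aux x h1, aux y h2⟩, rfl⟩

/-- There are finitely many roots of quadratic polynomials with bounded Gaussian integral
coefficients. -/
theorem finite_quadratic_roots (M : ℝ) :
    {z : ℂ | ∃ A ∈ gaussianSubring, ∃ B ∈ gaussianSubring, ∃ C ∈ gaussianSubring,
      A ≠ 0 ∧ ‖A‖ ≤ M ∧ ‖B‖ ≤ M ∧ ‖C‖ ≤ M ∧ A * z ^ 2 + B * z + C = 0}.Finite := by
  classical
  apply (Polynomial.bUnion_roots_finite (RingHom.id ℂ) 2 (finite_gaussian_norm_le M)).subset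
  rintro z ⟨A, hA, B, hB, C, hC, hA0, hAM, hBM, hCM, hz⟩
  have hM : 0 ≤ M := (norm_nonneg A).trans hAM
  simp only [Set.mem_iUnion]
  refine ⟨Polynomial.C A * X ^ 2 + Polynomial.C B * X + Polynomial.C C,
    ⟨natDegree_quadratic_le, ?_⟩, ?_⟩
  · intro i
    rcases i with _ | _ | _ | i
    · simpa using ⟨hC, hCM⟩
    · simpa [coeff_X, coeff_C] using ⟨hB, hBM⟩
    · simpa [coeff_X, coeff_C] using ⟨hA, hAM⟩
    · simpa [coeff_X, coeff_C, coeff_X_pow] using hM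
  · have hne : Polynomial.C A * X ^ 2 + Polynomial.C B * X + Polynomial.C C ≠ 0 := by
      intro h0
      have := natDegree_quadratic (b := B) (c := C) hA0
      rw [h0] at this
      simp at this
    simp [hne, hz]

theorem DigitPair.exists_repeat {z z' a : ℕ → ℂ} (h : DigitPair z z' a) {A : ℂ}
    (hA : A ∈ gaussianSubring) (hA0 : A ≠ 0) (hB : A * (z 0 + z' 0) ∈ gaussianSubring)
    (hC : A * (z 0 * z' 0) ∈ gaussianSubring) : ∃ m n, m < n ∧ z m = z n := by
  set D := ‖A‖ * ‖z 0 - z' 0‖ with hD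
  have hD0 : 0 ≤ D := by positivity
  have hinf : {n | 1 / 100 ≤ ‖z n - z' n‖}.Infinite := by
    rw [Set.infinite_iff_exists_gt]
    intro N
    obtain ⟨n, hn, h'⟩ := h.exists_norm_sub_ge (N + 1)
    exact ⟨n, h', by omega⟩
  have hmaps : Set.MapsTo z {n | 1 / 100 ≤ ‖z n - z' n‖}
      {z : ℂ | ∃ A ∈ gaussianSubring, ∃ B ∈ gaussianSubring, ∃ C ∈ gaussianSubring,
        A ≠ 0 ∧ ‖A‖ ≤ 201 * D ∧ ‖B‖ ≤ 201 * D ∧ ‖C‖ ≤ 201 * D ∧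
        A * z ^ 2 + B * z + C = 0} := by
    intro n hn
    obtain ⟨E, hE, hE0, h1, h2, h3⟩ := h.exists_form hA hA0 hB hC n
    rw [← hD] at h3
    have hz1 := norm_le_one_of_abs (h.abs_le n)
    have hE100 : ‖E‖ ≤ 100 * D := by
      have hn' : 1 / 100 ≤ ‖z n - z' n‖ := hn
      nlinarith [norm_nonneg E]
    -- z' may be unbounded, but ‖E‖‖z'‖ ≤ ‖E‖‖z‖ + D; adding ‖E‖‖z‖ ≤ 100 D yields 201 D.
    have hz'1 : ‖E‖ * ‖z' n‖ ≤ 101 * D := by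
      have h4 := norm_sub_le (z n) (z n - z' n)
      rw [sub_sub_cancel] at h4
      nlinarith [norm_nonneg E]
    refine ⟨E, hE, _, neg_mem h1, _, h2, hE0, by linarith, ?_, ?_, by ring⟩
    · rw [norm_neg, norm_mul]
      nlinarith [norm_add_le (z n) (z' n), norm_nonneg E]
    · rw [norm_mul, norm_mul]
      nlinarith [norm_nonneg E, norm_nonneg (z n), norm_nonneg (z' n),
        mul_nonneg (norm_nonneg E) (norm_nonneg (z' n))]
  obtain ⟨m, -, n, -, hne, heq⟩ :=
    hinf.exists_ne_map_eq_of_mapsTo hmaps (finite_quadratic_roots (201 * D))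
  rcases lt_or_gt_of_ne hne with hlt | hlt
  · exact ⟨m, n, hlt, heq⟩
  · exact ⟨n, m, hlt, heq.symm⟩

/-! ### Denominators in ℚ(i) and the conjugate root -/

theorem I_mem_gaussianRationals : I ∈ GaussianRationals :=
  IntermediateField.mem_adjoin_simple_self ℚ I

theorem gaussianSubring_subset {z : ℂ} (h : z ∈ gaussianSubring) : z ∈ GaussianRationals := by
  obtain ⟨x, y, rfl⟩ := (mem_gaussianSubring_iff z).1 h
  exact add_mem (intCast_mem _ x) (mul_mem (intCast_mem _ y) I_mem_gaussianRationals)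

theorem intCast_mem_gaussianSubring (n : ℤ) : (n : ℂ) ∈ gaussianSubring := intCast_mem _ n

/-- Every element of `ℚ(i)` is a quotient of a Gaussian integer by a nonzero integer. -/
theorem exists_int_mul_mem {z : ℂ} (h : z ∈ GaussianRationals) :
    ∃ n : ℤ, n ≠ 0 ∧ (n : ℂ) * z ∈ gaussianSubring := by
  induction h using IntermediateField.adjoin_induction with
  | mem x hx =>
    rw [Set.mem_singleton_iff] at hx
    subst hx
    exact ⟨1, one_ne_zero, (mem_gaussianSubring_iff _).2 ⟨0, 1, by simp⟩⟩
  | algebraMap q =>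
    refine ⟨q.den, by exact_mod_cast q.den_nz, ?_⟩
    have : ((q.den : ℤ) : ℂ) * algebraMap ℚ ℂ q = (q.num : ℂ) := by
      have := Rat.den_mul_eq_num q
      simp only [eq_ratCast]
      exact_mod_cast congrArg (Rat.cast : ℚ → ℂ) this
    rw [this]
    exact intCast_mem_gaussianSubring _
  | add x y _ _ hx hy =>
    obtain ⟨m, hm, h1⟩ := hx
    obtain ⟨n, hn, h2⟩ := hy
    refine ⟨m * n, mul_ne_zero hm hn, ?_⟩
    have : ((m * n : ℤ) : ℂ) * (x + y) = n * (m * x) + m * (n * y) := by push_cast; ring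
    rw [this]
    exact add_mem (mul_mem (intCast_mem_gaussianSubring _) h1)
      (mul_mem (intCast_mem_gaussianSubring _) h2)
  | inv x _ hx =>
    obtain ⟨m, hm, h1⟩ := hx
    by_cases hx0 : x = 0
    · exact ⟨1, one_ne_zero, by simp [hx0, zero_mem]⟩
    obtain ⟨w, hw⟩ := h1
    have hw0 : w ≠ 0 := by
      rintro rfl
      simp [hm, hx0] at hw
    -- With w = m x, x⁻¹ = m w̄ / N(w).
    refine ⟨w.norm, (GaussianInt.norm_pos.2 hw0).ne', ?_⟩
    have hnorm : ((w.norm : ℤ) : ℂ) = GaussianInt.toComplex w * GaussianInt.toComplex (star w) := by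
      rw [← map_mul, ← Zsqrtd.norm_eq_mul_conj]
      simp
    rw [hnorm, hw, show (m : ℂ) * x * GaussianInt.toComplex (star w) * x⁻¹ =
      m * GaussianInt.toComplex (star w) by field_simp]
    exact mul_mem (intCast_mem_gaussianSubring _) ⟨_, rfl⟩
  | mul x y _ _ hx hy =>
    obtain ⟨m, hm, h1⟩ := hx
    obtain ⟨n, hn, h2⟩ := hy
    refine ⟨m * n, mul_ne_zero hm hn, ?_⟩
    have : ((m * n : ℤ) : ℂ) * (x * y) = (m * x) * (n * y) := by push_cast; ring
    rw [this]
    exact mul_mem h1 h2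

/-- The conjugate root of a quadratic irrational, with a common denominator for the symmetric
functions of both roots. -/
theorem exists_conjugate {α : ℂ} (hα : α ∉ GaussianRationals)
    (hquad : IsQuadraticOverGaussianRationals α) :
    ∃ α' : ℂ, α' ∉ GaussianRationals ∧ α ≠ α' ∧ ∃ n : ℤ, n ≠ 0 ∧
      (n : ℂ) * (α + α') ∈ gaussianSubring ∧ (n : ℂ) * (α * α') ∈ gaussianSubring := by
  obtain ⟨hint, hdeg⟩ := hquad
  set p := minpoly GaussianRationals α with hp
  have hroot : ((p.coeff 0 : GaussianRationals) : ℂ) + (p.coeff 1 : GaussianRationals) * α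
      + α ^ 2 = 0 := by
    have h1 := minpoly.aeval GaussianRationals α
    rw [← hp, aeval_eq_sum_range, hdeg] at h1
    have hm : p.coeff 2 = 1 := by
      have := minpoly.monic hint
      rw [← hp, Monic, leadingCoeff, hdeg] at this
      exact this
    simpa [Finset.sum_range_succ, hm, Algebra.smul_def] using h1
  have hb := (p.coeff 1).2
  have hc := (p.coeff 0).2
  generalize ((p.coeff 1 : GaussianRationals) : ℂ) = b at hroot hb
  generalize ((p.coeff 0 : GaussianRationals) : ℂ) = c at hroot hc
  have hsum : α + (-b - α) = -b := by ring
  have hprod : α * (-b - α) = c := by linear_combination -hroot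
  refine ⟨-b - α, ?_, ?_, ?_⟩
  · intro h
    apply hα
    have := sub_mem (neg_mem hb) h
    simpa using this
  · intro h
    apply hα
    have h2 : α = -b / 2 := by linear_combination h / 2
    rw [h2]
    exact div_mem (neg_mem hb) (ofNat_mem _ 2)
  · obtain ⟨m, hm, h1⟩ := exists_int_mul_mem (neg_mem hb)
    obtain ⟨n, hn, h2⟩ := exists_int_mul_mem hc
    refine ⟨m * n, mul_ne_zero hm hn, ?_, ?_⟩
    · rw [hsum, show ((m * n : ℤ) : ℂ) * -b = n * (m * -b) by push_cast; ring]
      exact mul_mem (intCast_mem_gaussianSubring _) h1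
    · rw [hprod, show ((m * n : ℤ) : ℂ) * c = m * (n * c) by push_cast; ring]
      exact mul_mem (intCast_mem_gaussianSubring _) h2

/-! ### The Tanaka orbit and its conjugate -/

theorem ne_zero_of_not_mem {z : ℂ} (h : z ∉ GaussianRationals) : z ≠ 0 := by
  rintro rfl
  exact h (zero_mem _)

theorem one_div_sub_not_mem {z a : ℂ} (h : z ∉ GaussianRationals) (ha : a ∈ evenGaussian) :
    1 / z - a ∉ GaussianRationals := by
  intro h1
  apply h
  have := inv_mem (add_mem h1 (gaussianSubring_subset (evenGaussian_subset ha)))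
  simpa using this

theorem tanakaOrbit_succ (α : ℂ) (n : ℕ) :
    tanakaOrbit α (n + 1) = tanakaMap (tanakaOrbit α n) :=
  Function.iterate_succ_apply' _ _ _

theorem tanakaMap_of_not_mem {z : ℂ} (h : z ∉ GaussianRationals) :
    tanakaMap z = 1 / z - tanakaFloor (1 / z) := by
  rw [tanakaMap, if_neg (ne_zero_of_not_mem h)]

theorem tanakaOrbit_not_mem {α : ℂ} (hα : α ∉ GaussianRationals) (n : ℕ) :
    tanakaOrbit α n ∉ GaussianRationals := by
  induction n with
  | zero => exact hα
  | succ n ih =>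
    rw [tanakaOrbit_succ, tanakaMap_of_not_mem ih]
    exact one_div_sub_not_mem ih (tanakaFloor_mem _)

theorem tanakaOrbit_mem {α : ℂ} (hα : α ∈ tanakaDomain) (n : ℕ) :
    tanakaOrbit α n ∈ tanakaDomain := by
  cases n with
  | zero => exact hα
  | succ n => rw [tanakaOrbit_succ]; exact tanakaMap_mem _

/-- The images of `α'` under the Möbius transformations given by the digits of `α`. -/
noncomputable def conjugateOrbit (α α' : ℂ) : ℕ → ℂ
  | 0 => α'
  | n + 1 => 1 / conjugateOrbit α α' n - tanakaFloor (1 / tanakaOrbit α n)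

theorem conjugateOrbit_not_mem {α α' : ℂ} (h : α' ∉ GaussianRationals) (n : ℕ) :
    conjugateOrbit α α' n ∉ GaussianRationals := by
  induction n with
  | zero => exact h
  | succ n ih => exact one_div_sub_not_mem ih (tanakaFloor_mem _)

theorem digitPair_tanakaOrbit {α α' : ℂ} (hX : α ∈ tanakaDomain) (hα : α ∉ GaussianRationals)
    (hα' : α' ∉ GaussianRationals) (hne : α ≠ α') :
    DigitPair (tanakaOrbit α) (conjugateOrbit α α')
      (fun n => tanakaFloor (1 / tanakaOrbit α n)) where
  abs_le n := abs_re_add_abs_im_le (tanakaOrbit_mem hX n)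
  ne_zero n := ne_zero_of_not_mem (tanakaOrbit_not_mem hα n)
  ne_zero' n := ne_zero_of_not_mem (conjugateOrbit_not_mem hα' n)
  not_mem n h := tanakaOrbit_not_mem hα n (gaussianSubring_subset (oddGaussian_subset h))
  not_mem' n h := conjugateOrbit_not_mem hα' n (gaussianSubring_subset (oddGaussian_subset h))
  ne n := by
    induction n with
    | zero => exact hne
    | succ n ih =>
      rw [tanakaOrbit_succ, tanakaMap_of_not_mem (tanakaOrbit_not_mem hα n), conjugateOrbit]
      intro h
      apply ih
      simpa using h
  digit n := tanakaFloor_mem _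
  succ n := by rw [tanakaOrbit_succ, tanakaMap_of_not_mem (tanakaOrbit_not_mem hα n)]
  succ' n := rfl

theorem isEventuallyPeriodic_of_repeat {α : ℂ} {m n : ℕ} (hmn : m < n)
    (h : tanakaOrbit α m = tanakaOrbit α n) : IsEventuallyPeriodic (tanakaOrbit α) := by
  refine ⟨m, n - m, by omega, fun k hk => ?_⟩
  induction k, hk using Nat.le_induction with
  | base => rw [Nat.add_sub_cancel' hmn.le, h]
  | succ k _ ih => rw [show k + 1 + (n - m) = k + (n - m) + 1 by ring, tanakaOrbit_succ, ih,
      tanakaOrbit_succ]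

theorem corollary3p4 (α : ℂ) (hX : α ∈ tanakaDomain) (hα : α ∉ GaussianRationals)
    (hquad : IsQuadraticOverGaussianRationals α) :
    (∀ n : ℕ, tanakaOrbit α n ≠ 0) ∧ IsEventuallyPeriodic (tanakaOrbit α) := by
  refine ⟨fun n => ne_zero_of_not_mem (tanakaOrbit_not_mem hα n), ?_⟩
  obtain ⟨α', hα', hne, k, hk, h1, h2⟩ := exists_conjugate hα hquad
  obtain ⟨m, n, hmn, h⟩ := (digitPair_tanakaOrbit hX hα hα' hne).exists_repeat
    (intCast_mem_gaussianSubring k) (Int.cast_ne_zero.2 hk) h1 h2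
  exact isEventuallyPeriodic_of_repeat hmn h
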